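/- Let $K$ be a field. For a homogeneous ideal $I$ of a standard graded polynomial ring $R=K[x_1,\dots,x_p]$ (with any number $p$ of variables), the Hilbert function of $R/I$ is $t\mapsto \dim_K R_t-\dim_K I_t$. A finite $O$-sequence is a sequence $(a_0,a_1,\dots,a_s)$ of non-negative integers with $a_s\neq 0$ that (extended by $a_t=0$ for $t>s$) is the Hilbert function of an Artinian quotient $R/I$ of this kind; its multiplicity is $\sum_{i=0}^{s} a_i$. For every integer $d\ge 1$ let $O_d$ be the number of finite $O$-sequences of multiplicity $d$, and let $A_d$ be the number of those whose last value satisfies $a_s>1$. Then: (1) for every $d\ge 1$ the number $O_d$ is finite and $O_d<2^d$; for every $d\ge 2$, $O_d=O_{d-1}+A_d$; (2) $A_{d-2}\le A_d$ for every $d\ge 3$, and $A_d\le A_{d-1}+A_{d-2}=O_{d-1}-O_{d-3}$ for every $d\ge 4$. -/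

import Mathlib

-- The grading of a polynomial ring by the total degree.
attribute [local instance] MvPolynomial.gradedAlgebra

/-- The Hilbert function `t ↦ dim_K R_t - dim_K I_t` of `R / I`, for an ideal `I` of the standard
graded polynomial ring `R = K[x_1, …, x_p]`. Here `R_t` is the (finite-dimensional) space of forms
of degree `t` and `I_t = I ∩ R_t ⊆ R_t`, so the subtraction of natural numbers never truncates. -/
noncomputable def hilbertFunction {K : Type*} [Field K] {p : ℕ}
    (I : Ideal (MvPolynomial (Fin p) K)) (t : ℕ) : ℕ :=
  Module.finrank K (MvPolynomial.homogeneousSubmodule (Fin p) K t) -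
    Module.finrank K
      (I.restrictScalars K ⊓ MvPolynomial.homogeneousSubmodule (Fin p) K t :
        Submodule K (MvPolynomial (Fin p) K))

/-- `H = (a_0, …, a_s)`, with `a_s ≠ 0`, is a finite O-sequence of socle degree `s`: the Hilbert
function of an Artinian quotient of a polynomial ring over `K` (in any finite number of variables)
by a homogeneous ideal. A finite sequence is a function on `ℕ` that vanishes after the index
`s`. -/
structure IsFiniteOSequence (K : Type*) [Field K] (H : ℕ → ℕ) (s : ℕ) : Prop where
  isHilbertFunction : ∃ (p : ℕ) (I : Ideal (MvPolynomial (Fin p) K)),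
    I.IsHomogeneous (MvPolynomial.homogeneousSubmodule (Fin p) K) ∧
    IsArtinianRing (MvPolynomial (Fin p) K ⧸ I) ∧
    ∀ t, H t = hilbertFunction I t
  last_ne_zero : H s ≠ 0
  eq_zero_of_gt : ∀ t, s < t → H t = 0

/-- The finite O-sequences of multiplicity `d`. -/
def oSequences (K : Type*) [Field K] (d : ℕ) : Set (ℕ → ℕ) :=
  {H | ∃ s, IsFiniteOSequence K H s ∧ ∑ t ∈ Finset.range (s + 1), H t = d}

/-- The finite O-sequences of multiplicity `d` whose last non-zero value is greater than `1`. -/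
def aSequences (K : Type*) [Field K] (d : ℕ) : Set (ℕ → ℕ) :=
  {H | ∃ s, IsFiniteOSequence K H s ∧ ∑ t ∈ Finset.range (s + 1), H t = d ∧ 1 < H s}

/-- The number `O_d`. -/
noncomputable def numO (K : Type*) [Field K] (d : ℕ) : ℕ := (oSequences K d).ncard

/-- The number `A_d`. -/
noncomputable def numA (K : Type*) [Field K] (d : ℕ) : ℕ := (aSequences K d).ncard

/-! ### Dimension as the number of leading indices -/

section LeadingIndices

/-! Taking lex-leading exponents turns O-sequences into counting functions, degree by degree, of
finite order ideals of monomials (`isFiniteOSequence_iff`). The rest is combinatorics of how the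
last value can change.

Going down is free: any monomials of top degree may be deleted (`IsOrderIdealCount.of_last_le`).
Going up uses compression: `pairShift` pushes an order ideal towards one variable without changing
its count. One can thus arrange that x_i^s lies in the ideal, and x_i^(s-1) x_j too if the last
value exceeds 1. Adding x_i^(s+1), respectively x_i^(s+1) and x_i^s x_j, appends the value 1,
respectively 2 (`update_one`, `update_two`).

A sequence of multiplicity d ≥ 2 ending in 1 is a unique extension of one of multiplicity d - 1, so
O_d = O_(d-1) + A_d. Lowering a last value above 1 by one gives A_d ≤ O_(d-1), hence O_d ≤ 2
O_(d-1). Appending 2 embeds A_(d-2) in A_d. Conversely, a sequence counted by A_d either ends in at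
least 3 and can be lowered within the A's, or ends in 2. In the latter case, for d ≥ 4, the value
before is at least 2 by `IsOrderIdealCount.succ_le_one`, and the 2 can be removed. -/

open Classical in
/-- The dimension of a space of vectors that are determined by finitely many coordinates is the
number of their leading indices. -/
theorem finrank_eq_card_leading {K W ι L : Type*} [Field K] [AddCommGroup W] [Module K W]
    [LinearOrder L] (V : Submodule K W) (S : Finset ι) (c : ι → W →ₗ[K] K) (key : ι → L)
    (hkey : Function.Injective key) (hV : ∀ v ∈ V, (∀ i ∈ S, c i v = 0) → v = 0) :
    Module.finrank K V =
      (S.filter fun i => ∃ v ∈ V, c i v ≠ 0 ∧ ∀ j ∈ S, key i < key j → c j v = 0).card := by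
  set T := S.filter fun i => ∃ v ∈ V, c i v ≠ 0 ∧ ∀ j ∈ S, key i < key j → c j v = 0 with hT
  let φ : V →ₗ[K] (T → K) := LinearMap.pi fun i => (c i).comp V.subtype
  -- The largest index at which a nonzero `v` has a nonzero coordinate is a leading index, so the
  -- coordinates in `T` detect `v`.
  have hφ : Function.Injective φ := by
    rw [injective_iff_map_eq_zero]
    intro v hv
    by_contra hne
    have hex : ∃ i ∈ S, c i v ≠ 0 := by
      by_contra! h
      exact hne (Subtype.ext (hV v v.2 h))
    obtain ⟨i₀, hi₀, hci₀⟩ := hex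
    obtain ⟨i, hi, hmax⟩ := (S.filter fun i => c i v ≠ 0).exists_max_image key
      ⟨i₀, Finset.mem_filter.2 ⟨hi₀, hci₀⟩⟩
    rw [Finset.mem_filter] at hi
    have hiT : i ∈ T := by
      refine Finset.mem_filter.2 ⟨hi.1, v, v.2, hi.2, fun j hj hij => ?_⟩
      by_contra hcj
      exact absurd (hmax j (Finset.mem_filter.2 ⟨hj, hcj⟩)) (not_le.2 hij)
    exact hi.2 (congrFun hv ⟨i, hiT⟩)
  have hfin : Module.Finite K V := Module.Finite.of_injective φ hφ
  apply le_antisymm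
  · simpa using LinearMap.finrank_le_finrank_of_injective hφ
  · have hch : ∀ i : T, ∃ v : V, c i v ≠ 0 ∧ ∀ j ∈ S, key i < key j → c j v = 0 := by
      rintro ⟨i, hi⟩
      obtain ⟨v, hv, h⟩ := (Finset.mem_filter.1 hi).2
      exact ⟨⟨v, hv⟩, h⟩
    choose f hf hf' using hch
    have hli : LinearIndependent K f := by
      rw [linearIndependent_iff']
      intro s g hg
      by_contra! hex
      obtain ⟨i₀, hi₀, hgi₀⟩ := hex
      obtain ⟨i, hi, hmax⟩ := (s.filter fun i => g i ≠ 0).exists_max_image (fun i => key i)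
        ⟨i₀, Finset.mem_filter.2 ⟨hi₀, hgi₀⟩⟩
      rw [Finset.mem_filter] at hi
      -- The coordinate at the largest index of the relation kills all its other terms, because
      -- their leading indices are smaller.
      have h0 := congrArg (fun v : V => c i v) hg
      simp only [Submodule.coe_sum, Submodule.coe_smul, map_sum, map_smul, smul_eq_mul,
        Submodule.coe_zero, map_zero] at h0
      rw [Finset.sum_eq_single i] at h0
      · exact (mul_ne_zero hi.2 (hf i)) h0
      · intro j hj hji
        by_cases hgj : g j = 0
        · simp [hgj]
        · have hle := hmax j (Finset.mem_filter.2 ⟨hj, hgj⟩)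
          have hlt : key j < key i :=
            lt_of_le_of_ne hle fun h => hji (Subtype.ext (hkey h))
          rw [hf' j i (Finset.mem_filter.1 i.2).1 hlt, mul_zero]
      · exact fun h => absurd hi.1 h
    simpa using hli.fintype_card_le_finrank

end LeadingIndices

/-! ### Hilbert functions and order ideals of monomials -/

section Macaulay

open Finset MvPolynomial

open Classical in
/-- The number of exponent vectors of degree `t` in `M`. -/
noncomputable def degreeCount {σ : Type*} [Fintype σ] (M : Set (σ → ℕ)) (t : ℕ) : ℕ :=
  ((piAntidiag (univ : Finset σ) t).filter (· ∈ M)).card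

theorem degreeCount_eq_card {σ : Type*} [Fintype σ] [DecidableEq σ] (M : Set (σ → ℕ))
    [DecidablePred (· ∈ M)] (t : ℕ) :
    degreeCount M t = ((piAntidiag (univ : Finset σ) t).filter (· ∈ M)).card := by
  unfold degreeCount
  congr!

/-- The exponents of the leading monomials of the forms in the ideal `I`, for the lexicographic
order. -/
def leadingExponents {K : Type*} [Field K] {p : ℕ} (I : Ideal (MvPolynomial (Fin p) K)) :
    Set (Fin p → ℕ) :=
  {m | ∃ f ∈ I, f.IsHomogeneous (∑ i, m i) ∧ f.coeff (Finsupp.equivFunOnFinite.symm m) ≠ 0 ∧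
    ∀ n, (MonomialOrder.lex (σ := Fin p)).toSyn (Finsupp.equivFunOnFinite.symm m) <
      (MonomialOrder.lex (σ := Fin p)).toSyn n → f.coeff n = 0}

variable {K : Type*} [Field K] {p : ℕ}

open Classical in
theorem finrank_inf_homogeneousSubmodule (I : Ideal (MvPolynomial (Fin p) K)) (t : ℕ) :
    Module.finrank K (I.restrictScalars K ⊓ homogeneousSubmodule (Fin p) K t :
      Submodule K (MvPolynomial (Fin p) K)) = degreeCount (leadingExponents I) t := by
  have hdeg : ∀ n : Fin p →₀ ℕ, n.degree = ∑ i, n i := fun n => Finsupp.degree_eq_sum n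
  rw [finrank_eq_card_leading _ (piAntidiag (univ : Finset (Fin p)) t)
    (fun m => lcoeff K (Finsupp.equivFunOnFinite.symm m))
    (fun m => (MonomialOrder.lex (σ := Fin p)).toSyn (Finsupp.equivFunOnFinite.symm m))]
  · rw [degreeCount_eq_card]
    congr 1
    ext m
    simp only [mem_filter]
    refine and_congr_right fun hm => ?_
    have hm' : ∑ i, m i = t := (mem_piAntidiag.1 hm).1
    constructor
    · rintro ⟨f, ⟨hfI, hf⟩, hc, h⟩
      have hf' : f.IsHomogeneous t := hf
      refine ⟨f, hfI, hm' ▸ hf, hc, fun n hn => ?_⟩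
      by_contra hne
      have hn' : n.degree = t := by
        rw [Finsupp.degree_eq_weight_one]
        exact hf' hne
      refine hne ?_
      have := h (Finsupp.equivFunOnFinite n) (by simpa [← hdeg] using hn') (by simpa using hn)
      simpa using this
    · rintro ⟨f, hfI, hf, hc, h⟩
      exact ⟨f, ⟨hfI, hm' ▸ hf⟩, hc, fun j _ hj => h _ hj⟩
  · exact fun a b h => Finsupp.equivFunOnFinite.symm.injective
      ((MonomialOrder.lex (σ := Fin p)).toSyn.injective h)
  · rintro f ⟨-, hf⟩ h
    have hf' : f.IsHomogeneous t := hf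
    ext n
    by_contra hne
    have hn' : n.degree = t := by
      rw [Finsupp.degree_eq_weight_one]
      exact hf' hne
    refine hne ?_
    have := h (Finsupp.equivFunOnFinite n) (by simpa [← hdeg] using hn')
    simpa using this

theorem leadingExponents_top :
    leadingExponents (⊤ : Ideal (MvPolynomial (Fin p) K)) = Set.univ := by
  refine Set.eq_univ_of_forall fun m =>
    ⟨monomial (Finsupp.equivFunOnFinite.symm m) 1, trivial, ?_, ?_, ?_⟩
  · exact isHomogeneous_monomial _ (by simp [Finsupp.degree_eq_sum])
  · simp
  · intro n hn
    rw [coeff_monomial, if_neg]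
    rintro rfl
    exact lt_irrefl _ hn

theorem degreeCount_compl_add {σ : Type*} [Fintype σ] (M : Set (σ → ℕ)) (t : ℕ) :
    degreeCount (Mᶜ) t + degreeCount M t = degreeCount (Set.univ : Set (σ → ℕ)) t := by
  classical
  rw [degreeCount_eq_card, degreeCount_eq_card, degreeCount_eq_card, add_comm]
  simpa using card_filter_add_card_filter_not (s := piAntidiag (univ : Finset σ) t) (· ∈ M)

theorem hilbertFunction_eq_degreeCount (I : Ideal (MvPolynomial (Fin p) K)) (t : ℕ) :
    hilbertFunction I t = degreeCount (leadingExponents I)ᶜ t := by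
  -- The dimension of R_t is the same count for the unit ideal.
  have htop := finrank_inf_homogeneousSubmodule (⊤ : Ideal (MvPolynomial (Fin p) K)) t
  rw [leadingExponents_top, Submodule.restrictScalars_top, top_inf_eq] at htop
  rw [hilbertFunction, htop, finrank_inf_homogeneousSubmodule,
    ← degreeCount_compl_add (leadingExponents I), Nat.add_sub_cancel]

theorem isUpperSet_leadingExponents (I : Ideal (MvPolynomial (Fin p) K)) :
    IsUpperSet (leadingExponents I) := by
  rintro m n hmn ⟨f, hfI, hf, hc, h⟩
  set o := MonomialOrder.lex (σ := Fin p)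
  obtain ⟨k, rfl⟩ : ∃ k, n = m + k := ⟨n - m, (add_tsub_cancel_of_le hmn).symm⟩
  have hadd : (Finsupp.equivFunOnFinite.symm (m + k) : Fin p →₀ ℕ) =
      Finsupp.equivFunOnFinite.symm k + Finsupp.equivFunOnFinite.symm m := by
    ext i; simp [add_comm]
  refine ⟨monomial (Finsupp.equivFunOnFinite.symm k) 1 * f, I.mul_mem_left _ hfI, ?_, ?_, ?_⟩
  · have : ∑ i, (m + k) i = ∑ i, k i + ∑ i, m i := by
      simp [sum_add_distrib, add_comm]
    rw [this]
    exact (isHomogeneous_monomial _ (by simp [Finsupp.degree_eq_sum])).mul hf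
  · rw [hadd, coeff_monomial_mul]
    simpa using hc
  · intro n hn
    rw [coeff_monomial_mul']
    split_ifs with hkn
    · rw [h, mul_zero]
      obtain ⟨l, rfl⟩ : ∃ l, n = Finsupp.equivFunOnFinite.symm k + l :=
        ⟨n - _, (add_tsub_cancel_of_le hkn).symm⟩
      rw [hadd, map_add, map_add] at hn
      rw [add_tsub_cancel_left]
      exact lt_of_add_lt_add_left hn
    · rfl

/-- The ideal spanned by the monomials with exponents outside a lower set. -/
noncomputable def complMonomialIdeal (K : Type*) [Field K] {p : ℕ} (M : Set (Fin p → ℕ)) :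
    Ideal (MvPolynomial (Fin p) K) :=
  Ideal.span ((fun n => monomial n (1 : K)) '' {n | (n : Fin p → ℕ) ∉ M})

theorem mem_complMonomialIdeal {M : Set (Fin p → ℕ)} (hM : IsLowerSet M)
    {f : MvPolynomial (Fin p) K} :
    f ∈ complMonomialIdeal K M ↔ ∀ n : Fin p →₀ ℕ, (n : Fin p → ℕ) ∈ M → f.coeff n = 0 := by
  rw [complMonomialIdeal, mem_ideal_span_monomial_image]
  constructor
  · intro h n hn
    by_contra hne
    obtain ⟨l, hl, hln⟩ := h n (mem_support_iff.2 hne)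
    exact hl (hM hln hn)
  · intro h n hn
    exact ⟨n, fun hnM => mem_support_iff.1 hn (h n hnM), le_rfl⟩

theorem isHomogeneous_complMonomialIdeal (M : Set (Fin p → ℕ)) :
    (complMonomialIdeal K M).IsHomogeneous (homogeneousSubmodule (Fin p) K) := by
  apply Ideal.homogeneous_span
  rintro _ ⟨n, -, rfl⟩
  exact ⟨n.degree, isHomogeneous_monomial _ rfl⟩

theorem leadingExponents_complMonomialIdeal {M : Set (Fin p → ℕ)} (hM : IsLowerSet M) :
    leadingExponents (complMonomialIdeal K M) = Mᶜ := by
  ext m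
  constructor
  · rintro ⟨f, hfI, -, hc, -⟩ hm
    exact hc ((mem_complMonomialIdeal hM).1 hfI _ hm)
  · intro hm
    refine ⟨monomial (Finsupp.equivFunOnFinite.symm m) 1, ?_, ?_, ?_, ?_⟩
    · exact Ideal.subset_span ⟨_, hm, rfl⟩
    · exact isHomogeneous_monomial _ (by simp [Finsupp.degree_eq_sum])
    · simp
    · intro n hn
      rw [coeff_monomial, if_neg]
      rintro rfl
      exact lt_irrefl _ hn

theorem isArtinianRing_quotient_complMonomialIdeal {M : Set (Fin p → ℕ)} (hM : IsLowerSet M)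
    (hfin : M.Finite) : IsArtinianRing (MvPolynomial (Fin p) K ⧸ complMonomialIdeal K M) := by
  have := hfin.to_subtype
  -- The ideal is the kernel of recording the finitely many coefficients in `M`, so the quotient is
  -- finite-dimensional.
  let φ : MvPolynomial (Fin p) K →ₗ[K] (M → K) :=
    LinearMap.pi fun m => lcoeff K (Finsupp.equivFunOnFinite.symm m)
  have hker : LinearMap.ker φ = (complMonomialIdeal K M).restrictScalars K := by
    ext f
    rw [Submodule.restrictScalars_mem, mem_complMonomialIdeal hM, LinearMap.mem_ker]
    constructor
    · intro h n hn
      have := congrFun h ⟨n, hn⟩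
      simpa [φ] using this
    · intro h
      ext m
      exact h _ m.2
  have hfinite : Module.Finite K
      (MvPolynomial (Fin p) K ⧸ (complMonomialIdeal K M).restrictScalars K) := by
    rw [← hker]
    exact Module.Finite.of_injective φ.quotKerEquivRange.toLinearMap
      φ.quotKerEquivRange.injective
  have : Module.Finite K (MvPolynomial (Fin p) K ⧸ complMonomialIdeal K M) := hfinite
  exact isArtinian_of_tower K inferInstance

theorem finite_of_degreeCount_eq_zero {σ : Type*} [Fintype σ] {M : Set (σ → ℕ)} {s : ℕ}
    (h : ∀ t, s < t → degreeCount M t = 0) : M.Finite := by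
  classical
  refine ((range (s + 1)).biUnion fun t => piAntidiag (univ : Finset σ) t).finite_toSet.subset ?_
  intro m hm
  simp only [coe_biUnion, Set.mem_iUnion, mem_coe, mem_range, mem_piAntidiag]
  refine ⟨∑ i, m i, ?_, rfl, fun _ _ => mem_univ _⟩
  by_contra hlt
  have := h (∑ i, m i) (by omega)
  rw [degreeCount_eq_card, card_eq_zero] at this
  have hmem : m ∈ (piAntidiag (univ : Finset σ) (∑ i, m i)).filter (· ∈ M) := by
    simp [hm]
  rw [this] at hmem
  simp at hmem

/-- `H` counts, degree by degree, the monomials of an order ideal of monomials. -/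
def IsOrderIdealCount (H : ℕ → ℕ) : Prop :=
  ∃ (p : ℕ) (M : Set (Fin p → ℕ)), IsLowerSet M ∧ ∀ t, H t = degreeCount M t

/-- Macaulay's basis theorem: finite O-sequences are the counting functions of the finite order
ideals of monomials. -/
theorem isFiniteOSequence_iff (K : Type*) [Field K] {H : ℕ → ℕ} {s : ℕ} :
    IsFiniteOSequence K H s ↔ IsOrderIdealCount H ∧ H s ≠ 0 ∧ ∀ t, s < t → H t = 0 := by
  constructor
  · rintro ⟨⟨p, I, -, -, hI⟩, hs, hgt⟩
    exact ⟨⟨p, _, (isUpperSet_leadingExponents I).compl,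
      fun t => (hI t).trans (hilbertFunction_eq_degreeCount I t)⟩, hs, hgt⟩
  · rintro ⟨⟨p, M, hM, hH⟩, hs, hgt⟩
    refine ⟨⟨p, complMonomialIdeal K M, isHomogeneous_complMonomialIdeal M,
      isArtinianRing_quotient_complMonomialIdeal hM
        (finite_of_degreeCount_eq_zero (s := s) fun t ht => (hH t) ▸ hgt t ht), fun t => ?_⟩,
      hs, hgt⟩
    rw [hH, hilbertFunction_eq_degreeCount, leadingExponents_complMonomialIdeal hM, compl_compl]

end Macaulay

/-! ### Compression of order ideals -/

section OrderIdeals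

open Finset

variable {σ : Type*} [DecidableEq σ]

theorem exists_eq_add_single {m : σ → ℕ} {k : σ} (h : 0 < m k) :
    ∃ n : σ → ℕ, m = n + Pi.single k 1 := by
  refine ⟨m - Pi.single k 1, funext fun l => ?_⟩
  by_cases hl : l = k
  · subst hl; simp; omega
  · simp [hl]

/-- The vector `m` with its entry at `j` replaced by `b` and its entry at `i` adjusted so that the
sum of the two entries is unchanged. -/
def pairMove (i j : σ) (m : σ → ℕ) (b : ℕ) : σ → ℕ :=
  Function.update (Function.update m i (m i + m j - b)) j b

section PairMove

variable {i j : σ} (m : σ → ℕ) (b : ℕ)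

@[simp]
theorem pairMove_right : pairMove i j m b j = b := by simp [pairMove]

theorem pairMove_left (hij : i ≠ j) : pairMove i j m b i = m i + m j - b := by
  simp [pairMove, hij]

theorem pairMove_of_ne {k : σ} (hi : k ≠ i) (hj : k ≠ j) : pairMove i j m b k = m k := by
  simp [pairMove, hi, hj]

theorem pairMove_self (hij : i ≠ j) : pairMove i j m (m j) = m := by
  funext k
  by_cases hj : k = j
  · subst hj; simp
  by_cases hi : k = i
  · subst hi; simp [pairMove_left _ _ hij]
  · exact pairMove_of_ne _ _ hi hj

variable {m b}

theorem pairMove_left_add_right (hij : i ≠ j) (hb : b ≤ m i + m j) :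
    pairMove i j m b i + pairMove i j m b j = m i + m j := by
  rw [pairMove_left _ _ hij, pairMove_right]; omega

theorem pairMove_pairMove (hij : i ≠ j) (hb : b ≤ m i + m j) (c : ℕ) :
    pairMove i j (pairMove i j m b) c = pairMove i j m c := by
  funext k
  by_cases hj : k = j
  · subst hj; simp
  by_cases hi : k = i
  · subst hi
    rw [pairMove_left (pairMove k j m b) c hij, pairMove_left_add_right hij hb,
      pairMove_left m c hij]
  · simp only [pairMove_of_ne _ _ hi hj]

theorem sum_pairMove [Fintype σ] (hij : i ≠ j) (hb : b ≤ m i + m j) :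
    ∑ k, pairMove i j m b k = ∑ k, m k := by
  rw [← sum_add_sum_compl {i, j}, ← sum_add_sum_compl {i, j} m, sum_pair hij, sum_pair hij,
    pairMove_left_add_right hij hb]
  congr 1
  refine sum_congr rfl fun k hk => ?_
  simp only [mem_compl, mem_insert, mem_singleton, not_or] at hk
  exact pairMove_of_ne _ _ hk.1 hk.2

end PairMove

open Classical in
/-- The number of vectors in `M` that differ from `m` by a move between the entries at `i` and
`j`. -/
noncomputable def pairCount (i j : σ) (M : Set (σ → ℕ)) (m : σ → ℕ) : ℕ :=
  ((range (m i + m j + 1)).filter fun b => pairMove i j m b ∈ M).card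

/-- The shift of `M` from `j` to `i`: on every line in the direction `e_i - e_j`, the vectors of
`M` are replaced by as many vectors with the smallest entries at `j`. -/
def pairShift (i j : σ) (M : Set (σ → ℕ)) : Set (σ → ℕ) :=
  {m | m j < pairCount i j M m}

variable {i j : σ} {M : Set (σ → ℕ)}

theorem pairCount_pairMove (hij : i ≠ j) {m : σ → ℕ} {b : ℕ} (hb : b ≤ m i + m j) :
    pairCount i j M (pairMove i j m b) = pairCount i j M m := by
  unfold pairCount
  rw [pairMove_left_add_right hij hb]
  congr 1
  ext c
  simp only [mem_filter, pairMove_pairMove hij hb]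

theorem pairCount_le (m : σ → ℕ) : pairCount i j M m ≤ m i + m j + 1 := by
  classical
  exact (card_filter_le _ _).trans (card_range _).le

theorem pairCount_pos (hij : i ≠ j) {m : σ → ℕ} (hm : m ∈ M) : 0 < pairCount i j M m := by
  classical
  refine card_pos.2 ⟨m j, mem_filter.2 ⟨mem_range.2 (by omega), ?_⟩⟩
  rwa [pairMove_self m hij]

/-- The lower shadow of a set of monomials of degree `t + 1` in two variables. -/
theorem min_card_le_card_shadow {t : ℕ} {B B' : Finset ℕ}
    (h₁ : ∀ b ∈ B, b ≤ t → b ∈ B') (h₂ : ∀ b ∈ B, 0 < b → b - 1 ∈ B') :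
    min B.card (t + 1) ≤ B'.card := by
  by_cases hall : range (t + 2) ⊆ B
  · have : range (t + 1) ⊆ B' := fun b hb => by
      rw [mem_range] at hb
      exact h₁ b (hall (mem_range.2 (by omega))) (by omega)
    exact (min_le_right _ _).trans ((card_range _).symm.le.trans (card_le_card this))
  · obtain ⟨b₀, hb₀, hb₀B⟩ := not_subset.1 hall
    rw [mem_range] at hb₀
    -- The gap `b₀` makes room: elements below it stay and those above it step down by one, without
    -- collision.
    refine (min_le_left _ _).trans (card_le_card_of_injOn (fun b => if b < b₀ then b else b - 1)
      (fun b hb => ?_) fun b hb c hc hbc => ?_)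
    · have hbB : b ∈ B := hb
      have hne : b ≠ b₀ := fun h => hb₀B (h ▸ hbB)
      dsimp only
      split_ifs with h
      · exact h₁ b hbB (by omega)
      · exact h₂ b hbB (by omega)
    · have hb' : b ≠ b₀ := fun h => hb₀B (h ▸ hb)
      have hc' : c ≠ b₀ := fun h => hb₀B (h ▸ hc)
      dsimp only at hbc
      split_ifs at hbc <;> omega

theorem isLowerSet_of_add_single [Fintype σ] {S : Set (σ → ℕ)}
    (h : ∀ m k, m + Pi.single k 1 ∈ S → m ∈ S) : IsLowerSet S := by
  have key : ∀ n : ℕ, ∀ a b : σ → ℕ, a ≤ b → ∑ k, b k = ∑ k, a k + n → b ∈ S → a ∈ S := by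
    intro n
    induction n with
    | zero =>
      intro a b hab hsum hb
      have : a = b := funext fun k =>
        (sum_eq_sum_iff_of_le fun k _ => hab k).1 hsum.symm k (mem_univ k)
      exact this ▸ hb
    | succ n ih =>
      intro a b hab hsum hb
      obtain ⟨k, -, hk⟩ : ∃ k ∈ univ, a k < b k := exists_lt_of_sum_lt (by omega)
      refine h a k (ih _ b (fun l => ?_) ?_ hb)
      · by_cases hl : l = k
        · subst hl; simpa using hk
        · simpa [hl] using hab l
      · simp [sum_add_distrib]; omega
  intro b a hab hb
  exact key (∑ k, b k - ∑ k, a k) a b hab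
    (by have := sum_le_sum fun k (_ : k ∈ univ) => hab k; omega) hb

/-- On each line the shifted set is an initial segment, so only segment lengths matter. Lowering the
entry at `i` or `j` leads to a line with one point fewer, where `min_card_le_card_shadow` bounds the
length from below. Lowering another entry leads to a parallel line of equal size, which contains
every position occupied before. -/
theorem isLowerSet_pairShift [Fintype σ] (hij : i ≠ j) (hM : IsLowerSet M) :
    IsLowerSet (pairShift i j M) := by
  classical
  refine isLowerSet_of_add_single fun m k hm => ?_
  change (m + Pi.single k 1 : σ → ℕ) j < pairCount i j M (m + Pi.single k 1) at hm
  change m j < pairCount i j M m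
  by_cases hk : k = i ∨ k = j
  · have hdeg : (m + Pi.single k 1 : σ → ℕ) i + (m + Pi.single k 1 : σ → ℕ) j =
        m i + m j + 1 := by
      rcases hk with rfl | rfl
      · simp [hij.symm]; omega
      · simp [hij]; omega
    have hle : ∀ b c, c ≤ b → b ≤ c + 1 → c ≤ m i + m j →
        pairMove i j m c ≤ pairMove i j (m + Pi.single k 1) b := by
      intro b c hcb hbc hc l
      by_cases hlj : l = j
      · subst hlj; simpa using hcb
      by_cases hli : l = i
      · subst hli
        rw [pairMove_left _ _ hij, pairMove_left _ _ hij, hdeg]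
        change m l + m j - c ≤ m l + m j + 1 - b
        omega
      · rw [pairMove_of_ne _ _ hli hlj, pairMove_of_ne _ _ hli hlj]
        simp
    have hmin : min (pairCount i j M (m + Pi.single k 1)) (m i + m j + 1) ≤ pairCount i j M m := by
      refine min_card_le_card_shadow ?_ ?_
      · intro b hb hbt
        rw [mem_filter] at hb ⊢
        exact ⟨mem_range.2 (by omega), hM (hle b b le_rfl (by omega) hbt) hb.2⟩
      · intro b hb hb0
        rw [mem_filter, mem_range, hdeg] at hb
        rw [mem_filter]
        exact ⟨mem_range.2 (by omega), hM (hle b (b - 1) (by omega) (by omega) (by omega)) hb.2⟩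
    have hjle : m j ≤ (m + Pi.single k 1 : σ → ℕ) j := by simp
    rw [min_le_iff] at hmin
    omega
  · rw [not_or] at hk
    have hi : (m + Pi.single k 1 : σ → ℕ) i = m i := by simp [Ne.symm hk.1]
    have hj : (m + Pi.single k 1 : σ → ℕ) j = m j := by simp [Ne.symm hk.2]
    rw [hj] at hm
    refine hm.trans_le (card_le_card fun b hb => ?_)
    rw [mem_filter, hi, hj] at hb
    rw [mem_filter]
    refine ⟨hb.1, hM (fun l => ?_) hb.2⟩
    by_cases hlj : l = j
    · subst hlj; simp
    by_cases hli : l = i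
    · subst hli
      rw [pairMove_left _ _ hij, pairMove_left _ _ hij, hi, hj]
    · rw [pairMove_of_ne _ _ hli hlj, pairMove_of_ne _ _ hli hlj]
      simp

/-- Each line has a unique representative `w` with entry 0 at `j`, and the entry at `j` is a
coordinate along it. Summing over these representatives shows that shifting preserves `degreeCount`.
-/
theorem card_line_eq_pairCount [Fintype σ] (hij : i ≠ j) (M : Set (σ → ℕ))
    [DecidablePred (· ∈ M)] {w : σ → ℕ} (hw : w j = 0) :
    (((piAntidiag univ (∑ k, w k)).filter (· ∈ M)).filter fun m => pairMove i j m 0 = w).card =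
      pairCount i j M w := by
  classical
  refine card_nbij' (fun m => m j) (fun b => pairMove i j w b) ?_ ?_ ?_ ?_
  · intro m hm
    simp only [coe_filter, mem_filter, Set.mem_ofPred_eq] at hm
    obtain ⟨⟨-, hmM⟩, rfl⟩ := hm
    have hdeg := pairMove_left_add_right (m := m) hij (Nat.zero_le _)
    simp only [coe_filter, Set.mem_ofPred_eq, mem_range]
    rw [pairMove_pairMove hij (Nat.zero_le _), pairMove_self m hij, hdeg]
    exact ⟨by omega, hmM⟩
  · intro b hb
    simp only [coe_filter, Set.mem_ofPred_eq, mem_range] at hb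
    have hb' : b ≤ w i + w j := by omega
    simp only [coe_filter, mem_filter, Set.mem_ofPred_eq, mem_piAntidiag]
    refine ⟨⟨⟨sum_pairMove hij hb', fun _ _ => mem_univ _⟩, hb.2⟩, ?_⟩
    rw [pairMove_pairMove hij hb']
    conv_rhs => rw [← pairMove_self w hij, hw]
  · intro m hm
    simp only [coe_filter, mem_filter, Set.mem_ofPred_eq] at hm
    obtain ⟨-, rfl⟩ := hm
    dsimp only
    rw [pairMove_pairMove hij (Nat.zero_le _), pairMove_self m hij]
  · intro b _
    exact pairMove_right _ _

theorem pairCount_pairShift (hij : i ≠ j) (w : σ → ℕ) :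
    pairCount i j (pairShift i j M) w = pairCount i j M w := by
  classical
  have : (range (w i + w j + 1)).filter (fun b => pairMove i j w b ∈ pairShift i j M) =
      range (pairCount i j M w) := by
    ext b
    rw [mem_filter, mem_range, mem_range]
    constructor
    · rintro ⟨hb, h⟩
      have h' : pairMove i j w b j < pairCount i j M (pairMove i j w b) := h
      rwa [pairMove_right, pairCount_pairMove hij (by omega)] at h'
    · intro h
      have hb := h.trans_le (pairCount_le w)
      refine ⟨hb, ?_⟩
      change pairMove i j w b j < pairCount i j M (pairMove i j w b)
      rwa [pairMove_right, pairCount_pairMove hij (by omega)]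
  unfold pairCount at this ⊢
  rw [this, card_range]

theorem degreeCount_pairShift [Fintype σ] (hij : i ≠ j) (M : Set (σ → ℕ)) (t : ℕ) :
    degreeCount (pairShift i j M) t = degreeCount M t := by
  classical
  have key : ∀ N : Set (σ → ℕ), degreeCount N t =
      ∑ w ∈ (piAntidiag univ t).filter (fun w : σ → ℕ => w j = 0), pairCount i j N w := by
    intro N
    rw [degreeCount_eq_card, card_eq_sum_card_fiberwise (f := fun m => pairMove i j m 0)
      (t := (piAntidiag univ t).filter (fun w : σ → ℕ => w j = 0))]
    · refine sum_congr rfl fun w hw => ?_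
      rw [mem_filter, mem_piAntidiag] at hw
      obtain ⟨⟨rfl, -⟩, hw⟩ := hw
      exact card_line_eq_pairCount hij N hw
    · intro m hm
      simp only [coe_filter, Set.mem_ofPred_eq, mem_piAntidiag] at hm ⊢
      exact ⟨⟨(sum_pairMove hij (Nat.zero_le _)).trans hm.1.1, fun _ _ => mem_univ _⟩,
        pairMove_right _ _⟩
  rw [key, key]
  exact sum_congr rfl fun w _ => pairCount_pairShift hij w

/-- Shifting all entries outside `Z` to the index `j` leaves the vectors supported in `Z` in
place. -/
theorem exists_shift_to [Fintype σ] (hM : IsLowerSet M) (Z : Finset σ) (hj : j ∉ Z) {u : σ → ℕ}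
    (hu : u ∈ M) :
    ∃ M' : Set (σ → ℕ), IsLowerSet M' ∧ (∀ t, degreeCount M' t = degreeCount M t) ∧
      (∀ m ∈ M, (∀ k, k ∉ Z → m k = 0) → m ∈ M') ∧
      ∃ u' ∈ M', (∀ k ∈ Z, u' k = u k) ∧ (∀ k, k ∉ Z → k ≠ j → u' k = 0) ∧ u j ≤ u' j ∧
        ∑ k, u' k = ∑ k, u k := by
  -- Induction on the part of the degree of `u` not yet collected at `j`.
  induction hn : ∑ k, u k - u j using Nat.strong_induction_on generalizing M u with
  | _ n ih =>
    by_cases hex : ∃ k, k ∉ Z ∧ k ≠ j ∧ u k ≠ 0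
    · obtain ⟨k, hkZ, hkj, huk⟩ := hex
      have hdeg := sum_pairMove (m := u) hkj.symm (Nat.zero_le (u j + u k))
      have hval := pairMove_left u 0 hkj.symm
      have hle : u j + u k ≤ ∑ l, u l := by
        rw [← sum_pair hkj.symm]
        exact sum_le_sum_of_subset (subset_univ _)
      obtain ⟨M', hM', hcard, hZ, u', hu', hu'Z, hu'0, hu'j, hsum⟩ :=
        ih _ (by rw [← hn]; rw [hdeg, hval]; omega) (isLowerSet_pairShift hkj.symm hM)
          (u := pairMove j k u 0) (by
            change pairMove j k u 0 k < _
            rw [pairMove_right, pairCount_pairMove hkj.symm (Nat.zero_le _)]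
            exact pairCount_pos hkj.symm hu) rfl
      refine ⟨M', hM', fun t => (hcard t).trans (degreeCount_pairShift hkj.symm M t), ?_, u', hu',
        ?_, hu'0, by omega, hsum.trans hdeg⟩
      · intro m hm hmZ
        -- Since `m k = 0`, the vector `m` is the first point of its line, and it survives because
        -- that line meets `M`.
        refine hZ m ?_ hmZ
        change m k < pairCount j k M m
        rw [hmZ k hkZ]
        exact pairCount_pos hkj.symm hm
      · intro l hl
        rw [hu'Z l hl, pairMove_of_ne]
        · rintro rfl; exact hj hl
        · rintro rfl; exact hkZ hl
    · push Not at hex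
      exact ⟨M, hM, fun _ => rfl, fun m hm _ => hm, u, hu, fun _ _ => rfl, hex, le_rfl, rfl⟩

/-- If an order ideal contains a monomial of degree `s`, then so does, with the pure power `x_i ^ s`
as that monomial, an order ideal with the same counting function. -/
theorem exists_single_mem [Fintype σ] (hM : IsLowerSet M) (i : σ) {u : σ → ℕ} (hu : u ∈ M) :
    ∃ M' : Set (σ → ℕ), IsLowerSet M' ∧ (∀ t, degreeCount M' t = degreeCount M t) ∧
      Pi.single i (∑ k, u k) ∈ M' := by
  obtain ⟨M', hM', hcard, -, u', hu', -, hu'0, -, hsum⟩ :=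
    exists_shift_to (j := i) hM ∅ (by simp) hu
  refine ⟨M', hM', hcard, ?_⟩
  have : u' = Pi.single i (∑ k, u k) := by
    have hz : ∀ k, k ≠ i → u' k = 0 := fun k hk => hu'0 k (by simp) hk
    rw [← hsum, sum_eq_single i (fun k _ hk => hz k hk) (by simp)]
    funext k
    by_cases hk : k = i
    · subst hk; simp
    · simp [hk, hz k hk]
  exact this ▸ hu'

/-- Collecting the entries of `v` away from `i` at some `j` preserves the pure power and puts a
second point on its line in direction `i`, `j`. A last shift from `j` to `i` moves two points to the
entries 0 and 1 at `j`. -/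
theorem exists_single_mem_and_pair_mem [Fintype σ] (hM : IsLowerSet M) {i : σ} {v : σ → ℕ}
    (hi : Pi.single i (∑ k, v k) ∈ M) (hv : v ∈ M) (hne : v ≠ Pi.single i (∑ k, v k)) :
    ∃ M' : Set (σ → ℕ), IsLowerSet M' ∧ (∀ t, degreeCount M' t = degreeCount M t) ∧
      Pi.single i (∑ k, v k) ∈ M' ∧
      ∃ j, i ≠ j ∧ pairMove i j (Pi.single i (∑ k, v k)) 1 ∈ M' := by
  classical
  obtain ⟨j, hji, hvj⟩ : ∃ j, j ≠ i ∧ v j ≠ 0 := by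
    by_contra! h
    refine hne (funext fun k => ?_)
    rw [sum_eq_single i (fun k _ hk => h k hk) (by simp)]
    by_cases hk : k = i
    · subst hk; simp
    · simp [hk, h k hk]
  obtain ⟨M₁, hM₁, hcard, hZ, u, hu, -, hu0, huj, hsum⟩ :=
    exists_shift_to (j := j) hM {i} (by simpa using hji) hv
  have hiM₁ := hZ _ hi (fun k hk => by
    have : k ≠ i := by simpa using hk
    simp [this])
  set s := ∑ k, v k with hs
  set w : σ → ℕ := Pi.single i s with hw
  have hwj : w j = 0 := by simp [hw, hji]
  have hwi : w i = s := by simp [hw]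
  have hus : u i + u j = s := by
    rw [← hsum, ← sum_pair hji.symm]
    refine sum_subset (subset_univ _) fun k _ hk => ?_
    simp only [mem_insert, mem_singleton, not_or] at hk
    exact hu0 k (by simpa using hk.1) hk.2
  have huw : pairMove i j w (u j) = u := by
    funext k
    by_cases hkj : k = j
    · subst hkj; simp
    by_cases hki : k = i
    · subst hki; rw [pairMove_left _ _ hji.symm]; omega
    · rw [pairMove_of_ne _ _ hki hkj, hu0 k (by simpa using hki) hkj]
      simp [hw, hki]
  have hcount : 1 < pairCount i j M₁ w := by
    refine one_lt_card.2 ⟨0, ?_, u j, ?_, by omega⟩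
    · refine mem_filter.2 ⟨by simp, ?_⟩
      have := pairMove_self w hji.symm
      rw [hwj] at this
      rwa [this]
    · refine mem_filter.2 ⟨mem_range.2 (by omega), ?_⟩
      rwa [huw]
  refine ⟨pairShift i j M₁, isLowerSet_pairShift hji.symm hM₁,
    fun t => (degreeCount_pairShift hji.symm M₁ t).trans (hcard t), ?_, j, hji.symm, ?_⟩
  · change w j < pairCount i j M₁ w
    omega
  · change pairMove i j w 1 j < pairCount i j M₁ (pairMove i j w 1)
    rwa [pairMove_right, pairCount_pairMove hji.symm (by omega)]

end OrderIdeals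

/-! ### Changing the last value of a counting function -/

section OrderIdealCount

open Finset

theorem mem_filter_piAntidiag {σ : Type*} [Fintype σ] [DecidableEq σ] {M : Set (σ → ℕ)}
    [DecidablePred (· ∈ M)] {t : ℕ} {m : σ → ℕ} :
    m ∈ (piAntidiag univ t).filter (· ∈ M) ↔ ∑ k, m k = t ∧ m ∈ M := by
  simp

theorem sum_add_single {σ : Type*} [Fintype σ] [DecidableEq σ] (m : σ → ℕ) (k : σ) :
    ∑ l, (m + Pi.single k 1 : σ → ℕ) l = ∑ l, m l + 1 := by
  simp [sum_add_distrib]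

theorem IsOrderIdealCount.zero_le_one {H : ℕ → ℕ} (h : IsOrderIdealCount H) : H 0 ≤ 1 := by
  classical
  obtain ⟨p, M, -, hH⟩ := h
  rw [hH, degreeCount_eq_card, piAntidiag_zero]
  exact (card_filter_le _ _).trans (by simp)

theorem IsOrderIdealCount.ne_zero_of_le {H : ℕ → ℕ} (h : IsOrderIdealCount H) {s t : ℕ}
    (hst : s ≤ t) (ht : H t ≠ 0) : H s ≠ 0 := by
  classical
  obtain ⟨p, M, hM, hH⟩ := h
  induction t, hst using Nat.le_induction with
  | base => exact ht
  | succ t _ ih =>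
    apply ih
    rw [hH, degreeCount_eq_card, card_ne_zero] at ht ⊢
    obtain ⟨m, hm⟩ := ht
    rw [mem_filter_piAntidiag] at hm
    obtain ⟨k, -, hk⟩ : ∃ k ∈ univ, m k ≠ 0 := exists_ne_zero_of_sum_ne_zero (by omega)
    obtain ⟨n, rfl⟩ := exists_eq_add_single (Nat.pos_of_ne_zero hk)
    rw [sum_add_single] at hm
    exact ⟨n, mem_filter_piAntidiag.2 ⟨by omega, hM (by simp) hm.2⟩⟩

/-- Reducing the last value of the counting function of an order ideal. -/
theorem IsOrderIdealCount.of_last_le {H H' : ℕ → ℕ} (h : IsOrderIdealCount H) {s : ℕ}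
    (hlt : ∀ t, t < s → H' t = H t) (hs : H' s ≤ H s) (hgt : ∀ t, s < t → H' t = 0) :
    IsOrderIdealCount H' := by
  classical
  obtain ⟨p, M, hM, hH⟩ := h
  rw [hH, degreeCount_eq_card] at hs
  -- Any choice of top-degree monomials works, since none of them divides another.
  obtain ⟨Y, hY, hYcard⟩ := exists_subset_card_eq hs
  have hY' : ∀ m ∈ Y, ∑ k, m k = s ∧ m ∈ M := fun m hm => mem_filter_piAntidiag.1 (hY hm)
  refine ⟨p, {m | m ∈ M ∧ ∑ k, m k < s} ∪ Y, isLowerSet_of_add_single ?_, fun t => ?_⟩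
  · rintro m k (⟨hm, hms⟩ | hm)
    · rw [sum_add_single] at hms
      exact Or.inl ⟨hM (by simp) hm, by omega⟩
    · have := hY' _ hm
      rw [sum_add_single] at this
      exact Or.inl ⟨hM (by simp) this.2, by omega⟩
  · rw [degreeCount_eq_card]
    rcases lt_trichotomy t s with ht | rfl | ht
    · rw [hlt t ht, hH, degreeCount_eq_card]
      congr 1
      ext m
      simp only [mem_filter_piAntidiag]
      refine and_congr_right fun hm => ⟨fun h => Or.inl ⟨h, by omega⟩, ?_⟩
      rintro (h | h)
      · exact h.1
      · exact (hY' m h).2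
    · rw [← hYcard]
      congr 1
      ext m
      simp only [mem_filter_piAntidiag]
      refine ⟨fun h => ⟨(hY' m h).1, Or.inr h⟩, ?_⟩
      rintro ⟨hm, h | h⟩
      · exact absurd h.2 (by omega)
      · exact h
    · rw [hgt t ht, eq_comm, card_eq_zero, eq_empty_iff_forall_notMem]
      intro m hm
      rw [mem_filter_piAntidiag] at hm
      obtain ⟨hm, h | h⟩ := hm
      · exact absurd h.2 (by omega)
      · exact absurd (hY' m h).1 (by omega)

/-- Adding monomials above the top degree of an order ideal. -/
theorem isOrderIdealCount_update {p : ℕ} {M : Set (Fin p → ℕ)} (hM : IsLowerSet M) {H : ℕ → ℕ}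
    (hH : ∀ t, H t = degreeCount M t) {s : ℕ} (hgt : ∀ t, s < t → H t = 0)
    (X : Finset (Fin p → ℕ)) (hXs : ∀ x ∈ X, ∑ k, x k = s + 1)
    (hX : ∀ m k, m + Pi.single k 1 ∈ X → m ∈ M) :
    IsOrderIdealCount (Function.update H (s + 1) X.card) := by
  classical
  have hMs : ∀ m ∈ M, ∑ k, m k ≤ s := by
    intro m hm
    by_contra hlt
    have h0 := hgt (∑ k, m k) (by omega)
    rw [hH, degreeCount_eq_card, card_eq_zero, eq_empty_iff_forall_notMem] at h0
    exact h0 m (mem_filter_piAntidiag.2 ⟨rfl, hm⟩)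
  refine ⟨p, M ∪ X, isLowerSet_of_add_single ?_, fun t => ?_⟩
  · rintro m k (hm | hm)
    · exact Or.inl (hM (by simp) hm)
    · exact Or.inl (hX m k hm)
  · rw [degreeCount_eq_card]
    by_cases ht : t = s + 1
    · subst ht
      rw [Function.update_self]
      congr 1
      ext m
      simp only [mem_filter_piAntidiag]
      refine ⟨fun h => ⟨hXs m h, Or.inr h⟩, ?_⟩
      rintro ⟨hm, h | h⟩
      · have := hMs m h
        omega
      · exact h
    · rw [Function.update_of_ne ht, hH, degreeCount_eq_card]
      congr 1
      ext m
      simp only [mem_filter_piAntidiag]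
      refine and_congr_right fun hm => ⟨Or.inl, ?_⟩
      rintro (h | h)
      · exact h
      · exact absurd (hXs m h) (by omega)

theorem add_single_eq_single {σ : Type*} [DecidableEq σ] {m : σ → ℕ} {i k : σ} {s : ℕ}
    (h : m + Pi.single k 1 = Pi.single i (s + 1)) : k = i ∧ m = Pi.single i s := by
  have hk : k = i := by
    by_contra hk
    have := congrFun h k
    simp [hk] at this
  subst hk
  refine ⟨rfl, funext fun l => ?_⟩
  have := congrFun h l
  by_cases hl : l = k
  · subst hl; simpa using this
  · simpa [hl] using this

/-- After compression x_i^s is present, and it is the only divisor of degree s of the new monomial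
x_i^(s+1). The case s = 0 is separate because the given polynomial ring may have no variables. -/
theorem IsOrderIdealCount.update_one {H : ℕ → ℕ} (h : IsOrderIdealCount H) {s : ℕ}
    (hs : H s ≠ 0) (hgt : ∀ t, s < t → H t = 0) :
    IsOrderIdealCount (Function.update H (s + 1) 1) := by
  classical
  rcases Nat.eq_zero_or_pos s with rfl | hp
  · have h0 : H 0 = 1 := by
      have := h.zero_le_one
      omega
    rw [← card_singleton (Pi.single 0 1 : Fin 1 → ℕ)]
    refine isOrderIdealCount_update (p := 1) (M := {0}) ?_ (fun t => ?_) hgt _ ?_ ?_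
    · intro a b hba ha
      rw [Set.mem_singleton_iff] at ha ⊢
      subst ha
      exact le_antisymm hba fun _ => Nat.zero_le _
    · rw [degreeCount_eq_card]
      rcases Nat.eq_zero_or_pos t with rfl | ht
      · simp [h0, filter_singleton]
      · rw [hgt t ht, eq_comm, card_eq_zero, eq_empty_iff_forall_notMem]
        intro m hm
        obtain ⟨hm, rfl⟩ := mem_filter_piAntidiag.1 hm
        simp at hm
        omega
    · intro x hx
      rw [mem_singleton] at hx
      simp [hx]
    · intro m k hm
      rw [mem_singleton] at hm
      simpa using (add_single_eq_single hm).2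
  obtain ⟨p, M, hM, hH⟩ := h
  rw [hH, degreeCount_eq_card, card_ne_zero] at hs
  obtain ⟨u, hu⟩ := hs
  obtain ⟨rfl, huM⟩ := mem_filter_piAntidiag.1 hu
  obtain ⟨i, -, -⟩ : ∃ i ∈ univ, u i ≠ 0 := exists_ne_zero_of_sum_ne_zero (by omega)
  obtain ⟨M', hM', hcard, hi⟩ := exists_single_mem hM i huM
  rw [← card_singleton (Pi.single i (∑ k, u k + 1) : Fin p → ℕ)]
  refine isOrderIdealCount_update hM' (fun t => (hH t).trans (hcard t).symm) hgt _ ?_ ?_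
  · intro x hx
    rw [mem_singleton] at hx
    simp [hx]
  · intro m k hm
    rw [mem_singleton] at hm
    exact (add_single_eq_single hm).2 ▸ hi

/-- The degree-s divisors of x_i^(s+1) and x_i^s x_j are just x_i^s and x_i^(s-1) x_j, and both can
be compressed into the ideal. -/
theorem IsOrderIdealCount.update_two {H : ℕ → ℕ} (h : IsOrderIdealCount H) {s : ℕ}
    (hs : 1 < H s) (hgt : ∀ t, s < t → H t = 0) :
    IsOrderIdealCount (Function.update H (s + 1) 2) := by
  classical
  have hp : 0 < s := by
    rcases Nat.eq_zero_or_pos s with rfl | hp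
    · exact absurd h.zero_le_one (by omega)
    · exact hp
  obtain ⟨p, M, hM, hH⟩ := h
  have hs0 : H s ≠ 0 := by omega
  rw [hH, degreeCount_eq_card, card_ne_zero] at hs0
  obtain ⟨u, hu⟩ := hs0
  obtain ⟨rfl, huM⟩ := mem_filter_piAntidiag.1 hu
  obtain ⟨i, -, -⟩ : ∃ i ∈ univ, u i ≠ 0 := exists_ne_zero_of_sum_ne_zero (by omega)
  obtain ⟨M₁, hM₁, hcard₁, hi₁⟩ := exists_single_mem hM i huM
  generalize hsu : ∑ k, u k = s at *
  rw [hH, ← hcard₁, degreeCount_eq_card] at hs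
  obtain ⟨v, hv, hvne⟩ := exists_mem_ne hs (Pi.single i s)
  obtain ⟨rfl, hvM⟩ := mem_filter_piAntidiag.1 hv
  obtain ⟨M₂, hM₂, hcard₂, hi₂, j, hij, hj₂⟩ := exists_single_mem_and_pair_mem hM₁ hi₁ hvM hvne
  generalize ∑ k, v k = s at *
  have hw : ∀ r, 0 < r → ∀ l, pairMove i j (Pi.single i r : Fin p → ℕ) 1 l =
      if l = j then 1 else if l = i then r - 1 else 0 := by
    intro r _ l
    split_ifs with hlj hli
    · subst hlj; simp
    · subst hli; rw [pairMove_left _ _ hij]; simp [hij.symm]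
    · rw [pairMove_of_ne _ _ hli hlj]; simp [hli]
  have hne : (Pi.single i (s + 1) : Fin p → ℕ) ≠ pairMove i j (Pi.single i (s + 1)) 1 := by
    intro he
    have := congrFun he j
    simp [hij.symm] at this
  rw [← card_pair hne]
  refine isOrderIdealCount_update hM₂
    (fun t => (hH t).trans ((hcard₂ t).trans (hcard₁ t)).symm) hgt _ ?_ ?_
  · intro x hx
    rw [mem_insert, mem_singleton] at hx
    rcases hx with rfl | rfl
    · simp
    · rw [sum_pairMove hij (by simp; omega)]
      simp
  · intro m k hm
    rw [mem_insert, mem_singleton] at hm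
    rcases hm with hm | hm
    · exact (add_single_eq_single hm).2 ▸ hi₂
    · have hval : ∀ l, m l + (Pi.single k 1 : Fin p → ℕ) l =
          if l = j then 1 else if l = i then s else 0 := by
        intro l
        have := congrFun hm l
        rw [hw (s + 1) (by omega)] at this
        simpa using this
      have hk : k = j ∨ k = i := by
        by_contra! hk
        have := hval k
        simp [hk.1, hk.2] at this
      rcases hk with rfl | rfl
      · have : m = Pi.single i s := by
          funext l
          have hl := hval l
          by_cases hlk : l = k
          · subst hlk; simpa [hij.symm] using hl
          · by_cases hli : l = i
            · subst hli; simpa [hlk] using hl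
            · simpa [hlk, hli] using hl
        exact this ▸ hi₂
      · have : m = pairMove k j (Pi.single k s) 1 := by
          funext l
          have hl := hval l
          rw [hw s hp]
          by_cases hlj : l = j
          · subst hlj; simpa [hij.symm] using hl
          · by_cases hlk : l = k
            · subst hlk
              simp [hij] at hl ⊢
              omega
            · simpa [hlj, hlk] using hl
        exact this ▸ hj₂

/-- An order ideal with exactly one monomial in some positive degree has at most one monomial in
the next degree. -/
theorem IsOrderIdealCount.succ_le_one {H : ℕ → ℕ} (h : IsOrderIdealCount H) {t : ℕ} (ht : 0 < t)
    (h1 : H t = 1) : H (t + 1) ≤ 1 := by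
  classical
  obtain ⟨p, M, hM, hH⟩ := h
  rw [hH, degreeCount_eq_card, card_eq_one] at h1
  obtain ⟨u, hu⟩ := h1
  have hmem : ∀ n : Fin p → ℕ, ∑ k, n k = t → n ∈ M → n = u := fun n hn hnM => by
    rw [← mem_singleton, ← hu]
    exact mem_filter_piAntidiag.2 ⟨hn, hnM⟩
  have hut : ∑ k, u k = t :=
    (mem_filter_piAntidiag.1 (hu ▸ mem_singleton_self u)).1
  have hpred : ∀ m : Fin p → ℕ, ∑ k, m k = t + 1 → m ∈ M → ∀ k, m k ≠ 0 →
      m = u + Pi.single k 1 := by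
    intro m hm hmM k hk
    obtain ⟨n, rfl⟩ := exists_eq_add_single (Nat.pos_of_ne_zero hk)
    rw [sum_add_single] at hm
    rw [hmem n (by omega) (hM (by simp) hmM)]
  obtain ⟨i, -, hi⟩ : ∃ i ∈ univ, u i ≠ 0 := exists_ne_zero_of_sum_ne_zero (by omega)
  -- Every such `m` is a multiple of `u`, hence divisible by the fixed variable `i` of `u`; dividing
  -- by that variable must again give `u`.
  have huniq : ∀ m : Fin p → ℕ, ∑ k, m k = t + 1 → m ∈ M → m = u + Pi.single i 1 := by
    intro m hm hmM
    obtain ⟨k, -, hk⟩ : ∃ k ∈ univ, m k ≠ 0 := exists_ne_zero_of_sum_ne_zero (by omega)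
    have hmk := hpred m hm hmM k hk
    refine hpred m hm hmM i ?_
    rw [hmk]
    simp [hi]
  rw [hH, degreeCount_eq_card, card_le_one]
  intro a ha b hb
  rw [mem_filter_piAntidiag] at ha hb
  rw [huniq a ha.1 ha.2, huniq b hb.1 hb.2]

end OrderIdealCount

/-! ### Counting O-sequences by multiplicity -/

section Counting

open Finset

/-- The last index at which `H` is non-zero. -/
noncomputable def lastIndex (H : ℕ → ℕ) : ℕ := sSup {t | H t ≠ 0}

/-- The sequence `H` extended by the value `c`. -/
noncomputable def appendValue (c : ℕ) (H : ℕ → ℕ) : ℕ → ℕ :=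
  Function.update H (lastIndex H + 1) c

/-- The sequence `H` with its last value increased by one. -/
noncomputable def incrLast (H : ℕ → ℕ) : ℕ → ℕ :=
  Function.update H (lastIndex H) (H (lastIndex H) + 1)

theorem lastIndex_eq {H : ℕ → ℕ} {s : ℕ} (hs : H s ≠ 0) (hgt : ∀ t, s < t → H t = 0) :
    lastIndex H = s := by
  refine IsGreatest.csSup_eq ⟨hs, fun t ht => ?_⟩
  by_contra hlt
  exact ht (hgt t (not_le.1 hlt))

theorem sum_range_update_last (H : ℕ → ℕ) (s c : ℕ) :
    ∑ t ∈ range (s + 1), Function.update H s c t = ∑ t ∈ range s, H t + c := by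
  rw [sum_range_succ, Function.update_self]
  congr 1
  refine sum_congr rfl fun t ht => Function.update_of_ne ?_ _ _
  have := mem_range.1 ht
  omega

variable {K : Type*} [Field K] {H : ℕ → ℕ} {s d : ℕ}

namespace IsFiniteOSequence

theorem isOrderIdealCount (h : IsFiniteOSequence K H s) : IsOrderIdealCount H :=
  ((isFiniteOSequence_iff K).1 h).1

theorem lastIndex_eq (h : IsFiniteOSequence K H s) : lastIndex H = s :=
  _root_.lastIndex_eq h.last_ne_zero h.eq_zero_of_gt

theorem zero_eq_one (h : IsFiniteOSequence K H s) : H 0 = 1 := by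
  have := h.isOrderIdealCount.zero_le_one
  have := h.isOrderIdealCount.ne_zero_of_le (Nat.zero_le s) h.last_ne_zero
  omega

theorem appendValue_eq (h : IsFiniteOSequence K H s) (c : ℕ) :
    appendValue c H = Function.update H (s + 1) c := by
  rw [appendValue, h.lastIndex_eq]

theorem append (h : IsFiniteOSequence K H s) {c : ℕ} (hc : c ≠ 0)
    (hcount : IsOrderIdealCount (Function.update H (s + 1) c)) :
    IsFiniteOSequence K (appendValue c H) (s + 1) := by
  rw [h.appendValue_eq, isFiniteOSequence_iff]
  refine ⟨hcount, by simpa using hc, fun t ht => ?_⟩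
  rw [Function.update_of_ne (by omega)]
  exact h.eq_zero_of_gt t (by omega)

theorem append_one (h : IsFiniteOSequence K H s) :
    IsFiniteOSequence K (appendValue 1 H) (s + 1) :=
  h.append one_ne_zero (h.isOrderIdealCount.update_one h.last_ne_zero h.eq_zero_of_gt)

theorem append_two (h : IsFiniteOSequence K H s) (hs : 1 < H s) :
    IsFiniteOSequence K (appendValue 2 H) (s + 1) :=
  h.append two_ne_zero (h.isOrderIdealCount.update_two hs h.eq_zero_of_gt)

theorem sum_append (h : IsFiniteOSequence K H s) (c : ℕ) :
    ∑ t ∈ range (s + 1 + 1), appendValue c H t = ∑ t ∈ range (s + 1), H t + c := by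
  rw [h.appendValue_eq, sum_range_update_last]

theorem exists_append_eq (h : IsFiniteOSequence K H (s + 1)) :
    ∃ G, IsFiniteOSequence K G s ∧ G s = H s ∧ appendValue (H (s + 1)) G = H ∧
      ∑ t ∈ range (s + 1), G t + H (s + 1) = ∑ t ∈ range (s + 1 + 1), H t := by
  have hG : IsFiniteOSequence K (Function.update H (s + 1) 0) s := by
    have hgt : ∀ t, s < t → Function.update H (s + 1) 0 t = 0 := fun t ht => by
      by_cases hts : t = s + 1
      · subst hts; simp
      · rw [Function.update_of_ne hts]
        exact h.eq_zero_of_gt t (by omega)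
    refine (isFiniteOSequence_iff K).2 ⟨h.isOrderIdealCount.of_last_le (s := s) (fun t ht => ?_) ?_
      hgt, ?_, hgt⟩
    · rw [Function.update_of_ne (by omega)]
    · rw [Function.update_of_ne (by omega)]
    · rw [Function.update_of_ne (by omega)]
      exact h.isOrderIdealCount.ne_zero_of_le (Nat.le_succ s) h.last_ne_zero
  refine ⟨_, hG, Function.update_of_ne (by omega) _ _, ?_, ?_⟩
  · rw [hG.appendValue_eq, Function.update_idem, Function.update_eq_self]
  · rw [sum_range_succ H (s + 1)]
    congr 1
    refine sum_congr rfl fun t ht => Function.update_of_ne ?_ _ _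
    have := mem_range.1 ht
    omega

theorem exists_incrLast_eq (h : IsFiniteOSequence K H s) (hs : 1 < H s) :
    ∃ G, IsFiniteOSequence K G s ∧ G s + 1 = H s ∧ incrLast G = H ∧
      ∑ t ∈ range (s + 1), G t + 1 = ∑ t ∈ range (s + 1), H t := by
  have hG : IsFiniteOSequence K (Function.update H s (H s - 1)) s := by
    have hgt : ∀ t, s < t → Function.update H s (H s - 1) t = 0 := fun t ht => by
      rw [Function.update_of_ne (by omega)]
      exact h.eq_zero_of_gt t ht
    refine (isFiniteOSequence_iff K).2 ⟨h.isOrderIdealCount.of_last_le (s := s) (fun t ht => ?_) ?_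
      hgt, ?_, hgt⟩
    · rw [Function.update_of_ne (by omega)]
    · simp
    · rw [Function.update_self]
      omega
  refine ⟨_, hG, ?_, ?_, ?_⟩
  · rw [Function.update_self]
    omega
  · rw [incrLast, hG.lastIndex_eq, Function.update_idem, Function.update_self,
      Nat.sub_add_cancel hs.le, Function.update_eq_self]
  · rw [sum_range_update_last, sum_range_succ]
    omega

end IsFiniteOSequence

/-- A nonzero appended value is visible as the last one, so the extension reveals where the original
sequence ended. -/
theorem injOn_appendValue (K : Type*) [Field K] {c : ℕ} (hc : c ≠ 0) :
    Set.InjOn (appendValue c) {H | ∃ s, IsFiniteOSequence K H s} := by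
  rintro G ⟨r, hG⟩ H ⟨s, hH⟩ heq
  rw [hG.appendValue_eq, hH.appendValue_eq] at heq
  have hlast : ∀ {F : ℕ → ℕ} {q : ℕ}, IsFiniteOSequence K F q →
      lastIndex (Function.update F (q + 1) c) = q + 1 := fun {F q} hF =>
    lastIndex_eq (by simpa using hc) fun t ht => by
      rw [Function.update_of_ne (by omega)]
      exact hF.eq_zero_of_gt t (by omega)
  have hrs : r = s := by
    have h1 := hlast hG
    rw [heq, hlast hH] at h1
    omega
  subst hrs
  funext t
  by_cases ht : t = r + 1
  · rw [hG.eq_zero_of_gt t (by omega), hH.eq_zero_of_gt t (by omega)]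
  · simpa [ht] using congrFun heq t

theorem aSequences_subset_oSequences (K : Type*) [Field K] (d : ℕ) :
    aSequences K d ⊆ oSequences K d :=
  fun _ ⟨s, h, hsum, _⟩ => ⟨s, h, hsum⟩

theorem oSequences_one_subset (K : Type*) [Field K] : oSequences K 1 ⊆ {Pi.single 0 1} := by
  rintro H ⟨s, h, hsum⟩
  rw [sum_range_succ', h.zero_eq_one] at hsum
  have hs : s = 0 := by
    by_contra hs
    obtain ⟨r, rfl⟩ := Nat.exists_eq_succ_of_ne_zero hs
    have h0 := sum_eq_zero_iff.1 (Nat.add_right_cancel (hsum.trans (zero_add 1).symm)) r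
      (by simp)
    exact h.last_ne_zero h0
  subst hs
  funext t
  rcases Nat.eq_zero_or_pos t with rfl | ht
  · simp [h.zero_eq_one]
  · rw [h.eq_zero_of_gt t ht, Pi.single_eq_of_ne (by omega)]

theorem aSequences_succ_subset (K : Type*) [Field K] (d : ℕ) :
    aSequences K (d + 1) ⊆ incrLast '' oSequences K d := by
  rintro H ⟨s, h, hsum, hs⟩
  obtain ⟨G, hG, -, rfl, hGsum⟩ := h.exists_incrLast_eq hs
  exact ⟨G, ⟨s, hG, by omega⟩, rfl⟩

theorem oSequences_succ (K : Type*) [Field K] (hd : 1 ≤ d) :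
    oSequences K (d + 1) = appendValue 1 '' oSequences K d ∪ aSequences K (d + 1) := by
  ext H
  constructor
  · rintro ⟨s, h, hsum⟩
    by_cases hs : 1 < H s
    · exact Or.inr ⟨s, h, hsum, hs⟩
    have hs1 : H s = 1 := by
      have := h.last_ne_zero
      omega
    rcases s with _ | s
    · rw [sum_range_one] at hsum
      omega
    · obtain ⟨G, hG, -, hGH, hGsum⟩ := h.exists_append_eq
      rw [hs1] at hGH hGsum
      exact Or.inl ⟨G, ⟨s, hG, by omega⟩, hGH⟩
  · rintro (⟨G, ⟨s, hG, hsum⟩, rfl⟩ | h)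
    · exact ⟨s + 1, hG.append_one, by rw [hG.sum_append, hsum]⟩
    · exact aSequences_subset_oSequences K _ h

theorem disjoint_append_one_aSequences (K : Type*) [Field K] (d e : ℕ) :
    Disjoint (appendValue 1 '' oSequences K d) (aSequences K e) := by
  rw [Set.disjoint_left]
  rintro _ ⟨G, ⟨s, hG, -⟩, rfl⟩ ⟨r, hr, -, hlast⟩
  have hrs : r = s + 1 := hr.lastIndex_eq.symm.trans hG.append_one.lastIndex_eq
  rw [hrs, hG.appendValue_eq, Function.update_self] at hlast
  exact lt_irrefl _ hlast

theorem appendValue_two_image_subset (K : Type*) [Field K] (d : ℕ) :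
    appendValue 2 '' aSequences K d ⊆ aSequences K (d + 2) := by
  rintro _ ⟨G, ⟨s, hG, hsum, hs⟩, rfl⟩
  exact ⟨s + 1, hG.append_two hs, by rw [hG.sum_append, hsum],
    by rw [hG.appendValue_eq, Function.update_self]; exact one_lt_two⟩

/-- A last value above 2 stays above 1 when lowered. A last value 2 cannot follow a 1 in positive
degree; the bound on `d` excludes the one exception, (1, 2). -/
theorem aSequences_subset_union (K : Type*) [Field K] (hd : 2 ≤ d) :
    aSequences K (d + 2) ⊆
      incrLast '' aSequences K (d + 1) ∪ appendValue 2 '' aSequences K d := by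
  rintro H ⟨s, h, hsum, hs⟩
  by_cases hs2 : H s = 2
  · right
    rcases s with _ | s
    · exact absurd h.zero_eq_one (by omega)
    obtain ⟨G, hG, hGs, hGH, hGsum⟩ := h.exists_append_eq
    rw [hs2] at hGH hGsum
    refine ⟨G, ⟨s, hG, by omega, ?_⟩, hGH⟩
    by_contra hlt
    have hG1 : H s = 1 := by
      have := hG.last_ne_zero
      omega
    rcases Nat.eq_zero_or_pos s with rfl | hpos
    · rw [sum_range_one] at hGsum
      omega
    · exact absurd (h.isOrderIdealCount.succ_le_one hpos hG1) (by omega)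
  · left
    obtain ⟨G, hG, hGs, rfl, hGsum⟩ := h.exists_incrLast_eq hs
    exact ⟨G, ⟨s, hG, by omega, by omega⟩, rfl⟩

theorem finite_oSequences_and_card_le (K : Type*) [Field K] (d : ℕ) :
    (oSequences K (d + 1)).Finite ∧ numO K (d + 1) ≤ 2 ^ d := by
  induction d with
  | zero =>
    refine ⟨(Set.finite_singleton _).subset (oSequences_one_subset K), ?_⟩
    exact (Set.ncard_le_ncard (oSequences_one_subset K)).trans (by simp)
  | succ d ih =>
    obtain ⟨hfin, hcard⟩ := ih
    have hsub : oSequences K (d + 1 + 1) ⊆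
        appendValue 1 '' oSequences K (d + 1) ∪ incrLast '' oSequences K (d + 1) := by
      rw [oSequences_succ K (by omega)]
      exact Set.union_subset_union_right _ (aSequences_succ_subset K _)
    have hfin' := (hfin.image (appendValue 1)).union (hfin.image incrLast)
    refine ⟨hfin'.subset hsub, ?_⟩
    have h1 := Set.ncard_le_ncard hsub hfin'
    have h2 := Set.ncard_union_le (appendValue 1 '' oSequences K (d + 1))
      (incrLast '' oSequences K (d + 1))
    have h3 := Set.ncard_image_le (f := appendValue 1) hfin
    have h4 := Set.ncard_image_le (f := incrLast) hfin
    unfold numO at hcard ⊢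
    rw [pow_succ]
    omega

theorem finite_oSequences (K : Type*) [Field K] (hd : 1 ≤ d) : (oSequences K d).Finite := by
  obtain ⟨d, rfl⟩ := Nat.exists_eq_add_of_le' hd
  exact (finite_oSequences_and_card_le K d).1

theorem finite_aSequences (K : Type*) [Field K] (hd : 1 ≤ d) : (aSequences K d).Finite :=
  (finite_oSequences K hd).subset (aSequences_subset_oSequences K d)

theorem numO_succ (K : Type*) [Field K] (hd : 1 ≤ d) :
    numO K (d + 1) = numO K d + numA K (d + 1) := by
  have hfin := finite_oSequences K hd
  have hinj : Set.InjOn (appendValue 1) (oSequences K d) :=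
    (injOn_appendValue K one_ne_zero).mono fun _ hH => hH.imp fun _ h => h.1
  unfold numO numA
  rw [oSequences_succ K hd, Set.ncard_union_eq (disjoint_append_one_aSequences K d (d + 1))
    (hfin.image _) (finite_aSequences K (by omega)), hinj.ncard_image]

theorem numA_le_numA_add_two (K : Type*) [Field K] (d : ℕ) : numA K d ≤ numA K (d + 2) := by
  have hinj : Set.InjOn (appendValue 2) (aSequences K d) :=
    (injOn_appendValue K two_ne_zero).mono fun _ hH => hH.imp fun _ h => h.1
  unfold numA
  rw [← hinj.ncard_image]
  exact Set.ncard_le_ncard (appendValue_two_image_subset K d) (finite_aSequences K (by omega))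

theorem numA_add_two_le (K : Type*) [Field K] (hd : 2 ≤ d) :
    numA K (d + 2) ≤ numA K (d + 1) + numA K d := by
  have h1 := finite_aSequences K (d := d + 1) (by omega)
  have h2 := finite_aSequences K (d := d) (by omega)
  unfold numA
  exact (Set.ncard_le_ncard (aSequences_subset_union K hd)
    ((h1.image _).union (h2.image _))).trans ((Set.ncard_union_le _ _).trans
      (add_le_add (Set.ncard_image_le h1) (Set.ncard_image_le h2)))

end Counting

theorem lemma2p1 (K : Type*) [Field K] :
    (∀ d : ℕ, 1 ≤ d → (oSequences K d).Finite) ∧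
    (∀ d : ℕ, 2 ≤ d → numO K d = numO K (d - 1) + numA K d) ∧
    (∀ d : ℕ, 1 ≤ d → numO K d < 2 ^ d) ∧
    (∀ d : ℕ, 3 ≤ d → numA K (d - 2) ≤ numA K d) ∧
    (∀ d : ℕ, 4 ≤ d → numA K d ≤ numA K (d - 1) + numA K (d - 2) ∧
      ((numA K (d - 1) + numA K (d - 2) : ℕ) : ℤ) = (numO K (d - 1) : ℤ) - (numO K (d - 3) : ℤ)) := by
  refine ⟨fun d hd => finite_oSequences K hd, fun d hd => ?_, fun d hd => ?_, fun d hd => ?_,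
    fun d hd => ?_⟩
  · obtain ⟨d, rfl⟩ := Nat.exists_eq_add_of_le' hd
    exact numO_succ K (by omega)
  · obtain ⟨d, rfl⟩ := Nat.exists_eq_add_of_le' hd
    exact (finite_oSequences_and_card_le K d).2.trans_lt
      (Nat.pow_lt_pow_right one_lt_two (Nat.lt_succ_self d))
  · obtain ⟨d, rfl⟩ := Nat.exists_eq_add_of_le' (show 2 ≤ d by omega)
    exact numA_le_numA_add_two K d
  · obtain ⟨d, rfl⟩ := Nat.exists_eq_add_of_le' hd
    -- Two consecutive instances of the recursion telescope to the difference of the O's.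
    have h1 := numO_succ K (d := d + 1) (by omega)
    have h2 := numO_succ K (d := d + 2) (by omega)
    have h3 := numA_add_two_le K (d := d + 2) (by omega)
    refine ⟨h3, ?_⟩
    change ((numA K (d + 3) + numA K (d + 2) : ℕ) : ℤ) =
      (numO K (d + 3) : ℤ) - (numO K (d + 1) : ℤ)
    rw [show d + 1 + 1 = d + 2 from rfl] at h1
    rw [show d + 2 + 1 = d + 3 from rfl] at h2
    push_cast
    omega
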